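/- **Theorem (Asymptotic normality of the maximum likelihood estimator).** Let $\Theta\subseteq\mathbb R$, let $\nu$ be a measure on a measurable space $\mathcal X$ (for instance Lebesgue measure on $\mathbb R$, or a counting measure), and let $\{\psi_t\}_{t\in\Theta}$ be probability densities on $\mathcal X$ with respect to $\nu$. Let $X_1,X_2,\dots$ be random variables with values in $\mathcal X$ that, for each $t\in\Theta$, are i.i.d. with density $\psi_t$ under the probability measure $\mathcal P_t$. For $\mathbf x=(x_1,\dots,x_n)$ write $L^{(n)}(\mathbf x;t)=\prod_{j=1}^n\psi_t(x_j)$ for the likelihood and $l^{(n)}=\ln L^{(n)}$ for the log-likelihood, and let $$\mathscr F_{(n)}(\theta)=\operatorname{var}_{\theta}\Big(\tfrac{\partial}{\partial\theta}\,l^{(n)}(X_1,\dots,X_n;\theta)\Big)$$ be the Fisher information of the sample of size $n$. Let $\theta\in\Theta$ be such that the model is regular at $\theta$: there is an open interval $U\subseteq\Theta$ centred at $\theta$ such that 1. for $\nu$-almost every $x$, the function $t\mapsto\psi_t(x)$ is positive and twice continuously differentiable on $U$; 2. there is a $\nu$-integrable function $g$ with $|\partial_t\psi_t(x)|\le g(x)$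 and $|\partial_t^2\psi_t(x)|\le g(x)$ for all $t\in U$ and $\nu$-almost every $x$; 3. there is a function $H$ with $\mathbb E_\theta|H(X_1)|<\infty$ and $|\partial_t^2\ln\psi_t(x)|\le H(x)$ for all $t\in U$ and $\nu$-almost every $x$; and assume $\mathscr F_{(1)}(\theta)>0$. Let $\widehat\theta_n=h_n(X_1,\dots,X_n)$, with $h_n:\mathcal X^n\to\mathbb R$ measurable, be a maximum likelihood estimator, in the sense that the $\mathcal P_\theta$-probability that $\widehat\theta_n\in\Theta$ and $L^{(n)}(X_1,\dots,X_n;\widehat\theta_n)=\max_{t\in\Theta}L^{(n)}(X_1,\dots,X_n;t)$ tends to $1$ as $n\to\infty$ (in particular, if this always holds). If $\widehat\theta_n$ is consistent, that is, $\widehat\theta_n\to\theta$ in $\mathcal P_\theta$-probability, then, under $\mathcal P_\theta$, $$\sqrt n\,(\widehat\theta_n-\theta)\to\mathcal N\big(0,\mathscr F_{(1)}(\theta)^{-1}\big)\quad\text{in distribution}.$$ Moreover $\mathscr F_{(n)}(\theta)=n\,\mathscr F_{(1)}(\theta)$ for all $n$, and consequently $\widehat\theta_n\approx_{n\to\infty}\mathcal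 N(\theta,\mathscr F_{(n)}(\theta)^{-1})$, in the sense that $$\sup_{-\infty\le a\le b\le+\infty}\Big|\mathcal P_\theta(a\le\widehat\theta_n\le b)-\mathcal N\big(\theta,\mathscr F_{(n)}(\theta)^{-1}\big)\big([a,b]\big)\Big|\longrightarrow 0\quad (n\to\infty).$$ -/

import Mathlib

open MeasureTheory ProbabilityTheory Filter Topology
open scoped NNReal ENNReal

namespace MLE

noncomputable section

variable {𝓧 : Type*} [MeasurableSpace 𝓧]

/-- `ψ` is a one-parameter family of probability density functions with respect to the reference
measure `ν` on the observation space, indexed by the parameter set `Θ ⊆ ℝ`.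
(Lebesgue measure gives the continuous models, counting measure the discrete ones.) -/
structure IsDensityFamily (ν : Measure 𝓧) (Θ : Set ℝ) (ψ : ℝ → 𝓧 → ℝ) : Prop where
  measurable : ∀ t ∈ Θ, Measurable (ψ t)
  nonneg : ∀ t ∈ Θ, ∀ x, 0 ≤ ψ t x
  lintegral_eq_one : ∀ t ∈ Θ, ∫⁻ x, ENNReal.ofReal (ψ t x) ∂ν = 1

/-- The law of one observation when the parameter is `t`. -/
def obsLaw (ν : Measure 𝓧) (ψ : ℝ → 𝓧 → ℝ) (t : ℝ) : Measure 𝓧 :=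
  ν.withDensity fun x => ENNReal.ofReal (ψ t x)

/-- The likelihood function `L(x; t) = ∏ ψ_t(x_j)` of a sample of size `n`. -/
def likelihood (ψ : ℝ → 𝓧 → ℝ) (n : ℕ) (x : Fin n → 𝓧) (t : ℝ) : ℝ :=
  ∏ j, ψ t (x j)

/-- The log-likelihood function `l = ln L`. -/
def logLikelihood (ψ : ℝ → 𝓧 → ℝ) (n : ℕ) (x : Fin n → 𝓧) (t : ℝ) : ℝ :=
  Real.log (likelihood ψ n x t)

/-- The score: the derivative of the log-likelihood with respect to the parameter. -/
def score (ψ : ℝ → 𝓧 → ℝ) (n : ℕ) (t : ℝ) (x : Fin n → 𝓧) : ℝ :=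
  deriv (logLikelihood ψ n x) t

/-- The Fisher information `F_(n)(t)` of a sample of size `n`: the variance of the score when the
observations are independent with density `ψ_t`. -/
def fisherInfo (ν : Measure 𝓧) (ψ : ℝ → 𝓧 → ℝ) (n : ℕ) (t : ℝ) : ℝ :=
  Var[score ψ n t; Measure.pi fun _ : Fin n => obsLaw ν ψ t]

/-- The regularity conditions at the parameter value `θ`: on a neighbourhood of `θ` contained
in `Θ` the densities are positive and twice continuously differentiable in the parameter, their
first two derivatives are dominated by a `ν`-integrable function (so that one may differentiate
twice under the integral sign), and the second derivative of the log-density is dominated by a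
function with finite expectation at `θ`. -/
def IsRegularAt (ν : Measure 𝓧) (Θ : Set ℝ) (ψ : ℝ → 𝓧 → ℝ) (θ : ℝ) : Prop :=
  ∃ δ > 0, Metric.ball θ δ ⊆ Θ ∧
    (∀ᵐ x ∂ν, ∀ t ∈ Metric.ball θ δ, 0 < ψ t x) ∧
    (∀ᵐ x ∂ν, ContDiffOn ℝ 2 (fun t => ψ t x) (Metric.ball θ δ)) ∧
    (∃ g : 𝓧 → ℝ, Integrable g ν ∧ ∀ᵐ x ∂ν, ∀ t ∈ Metric.ball θ δ,
      |deriv (fun s => ψ s x) t| ≤ g x ∧ |iteratedDeriv 2 (fun s => ψ s x) t| ≤ g x) ∧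
    (∃ H : 𝓧 → ℝ, Integrable H (obsLaw ν ψ θ) ∧ ∀ᵐ x ∂ν, ∀ t ∈ Metric.ball θ δ,
      |iteratedDeriv 2 (fun s => Real.log (ψ s x)) t| ≤ H x)

variable {Ω : Type*} [MeasurableSpace Ω]

/-- The statistical model `X_j ∼ ψ_t`, `t ∈ Θ`: with respect to each `P t` the variables
`X 0, X 1, …` are i.i.d. with density `ψ_t`. -/
structure IsModel (ν : Measure 𝓧) (Θ : Set ℝ) (ψ : ℝ → 𝓧 → ℝ) (P : Θ → Measure Ω)
    (X : ℕ → Ω → 𝓧) : Prop where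
  density : IsDensityFamily ν Θ ψ
  measurable : ∀ j, Measurable (X j)
  indep : ∀ t, iIndepFun X (P t)
  law : ∀ t j, (P t).map (X j) = obsLaw ν ψ t

/-- The first `n` observations. -/
def sample (X : ℕ → Ω → 𝓧) (n : ℕ) (ω : Ω) : Fin n → 𝓧 := fun j => X j ω

/-- The random variable `θ̂_n = h_n(X_1, …, X_n)` obtained from a sequence of statistics. -/
def estimator (h : (n : ℕ) → (Fin n → 𝓧) → ℝ) (X : ℕ → Ω → 𝓧) (n : ℕ) (ω : Ω) : ℝ :=
  h n (sample X n ω)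

/-- `t` maximizes over `Θ` the likelihood of the data `x`. -/
def IsMaxLikelihood (Θ : Set ℝ) (ψ : ℝ → 𝓧 → ℝ) (n : ℕ) (x : Fin n → 𝓧) (t : ℝ) : Prop :=
  t ∈ Θ ∧ IsMaxOn (likelihood ψ n x) Θ t

/-- `h` is a (sequence of) maximum likelihood estimator(s) under `μ`: the probability that `h_n`
maximizes the likelihood of the sample tends to one (in particular when it always does). -/
def IsMLE (Θ : Set ℝ) (ψ : ℝ → 𝓧 → ℝ) (X : ℕ → Ω → 𝓧) (μ : Measure Ω)
    (h : (n : ℕ) → (Fin n → 𝓧) → ℝ) : Prop :=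
  Tendsto (fun n => μ {ω | ¬ IsMaxLikelihood Θ ψ n (sample X n ω) (estimator h X n ω)})
    atTop (𝓝 0)

/-- Consistency at the parameter `θ`: convergence to `θ` in probability under `μ`. -/
def IsConsistent (X : ℕ → Ω → 𝓧) (μ : Measure Ω) (h : (n : ℕ) → (Fin n → 𝓧) → ℝ)
    (θ : ℝ) : Prop :=
  TendstoInMeasure μ (estimator h X) atTop fun _ => θ

/-- `T n ≈ N(m, v n)` as `n → ∞`: the probabilities `μ (a ≤ T n ≤ b)`, `-∞ ≤ a, b ≤ ∞`, differ
from those of the normal law with mean `m` and variance `v n` by a quantity that tends to `0`,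
uniformly in the interval. -/
def ApproxNormal (μ : Measure Ω) (T : ℕ → Ω → ℝ) (m : ℝ) (v : ℕ → ℝ≥0) : Prop :=
  ∀ ε > 0, ∀ᶠ n in atTop, ∀ a b : EReal,
    |μ.real {ω | a ≤ (T n ω : EReal) ∧ (T n ω : EReal) ≤ b} -
      (gaussianReal m (v n)).real {y : ℝ | a ≤ (y : EReal) ∧ (y : EReal) ≤ b}| ≤ ε

end

end MLE

/-! ### Uniform convergence over intervals (Pólya's theorem) -/

namespace MLE

/-! Write `T` for the estimator, `D = √n (T - θ)`, `I` for the Fisher information of one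
observation, and `Z` for `n^(-1/2)` times the sum of the scores at `θ`. With probability tending to
one, `T` is an interior maximum, so the score vanishes there. Expanding it around `θ`
(`abs_sum_obsScore_add_le`) gives `Z + D * (J / n) = O((W / n) * |D|)`, where `J` sums the
derivatives of the scores at `θ` and `W` sums a bound on their oscillation near `θ`. By the law of
large numbers `J / n` tends to `-I`: this is the information identity `integral_obsScoreDeriv`,
obtained by differentiating `∫ ψ_t = 1` twice. The limit of `W / n` is as small as desired once the
neighbourhood is small (`exists_integrable_oscillation_bound`).

Hence `I * D = Z + o(|D|)` in probability. Chebyshev's inequality makes `Z` tight, which forces `D`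
to be tight and `D - Z / I` to vanish (`tendstoInMeasure_sub_of_asymptotically_linear`). The central
limit theorem for `Z / I` and Slutsky's lemma give the limit law. As this law has no atoms, the
convergence is uniform over intervals, and uniformity survives the affine change of variable from
`D` back to `T`. -/

lemma continuous_cdf (μ : Measure ℝ) [IsProbabilityMeasure μ] [NullSingletonClass μ] :
    Continuous (cdf μ) := by
  rw [continuous_iff_continuousAt]
  intro x
  rw [(monotone_cdf μ).continuousAt_iff_leftLim_eq_rightLim, StieltjesFunction.rightLim_eq]
  have h := StieltjesFunction.measure_singleton (cdf μ) x
  rw [measure_cdf, measure_singleton] at h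
  exact le_antisymm ((monotone_cdf μ).leftLim_le le_rfl)
    (sub_nonpos.1 (ENNReal.ofReal_eq_zero.1 h.symm))

/-- Intermediate value theorem for the cdf. The values `0` and `1` need not be attained at a real
point, so the empty set and the whole line serve there; the null frontier is what the portmanteau
theorem asks for. -/
lemma exists_isLowerSet_measureReal_eq (μ : Measure ℝ) [IsProbabilityMeasure μ] [NullSingletonClass μ]
    {p : ℝ} (hp0 : 0 ≤ p) (hp1 : p ≤ 1) :
    ∃ s : Set ℝ, IsLowerSet s ∧ μ (frontier s) = 0 ∧ μ.real s = p := by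
  rcases hp0.eq_or_lt with rfl | hp0
  · exact ⟨∅, isLowerSet_empty, by simp, by simp⟩
  rcases hp1.eq_or_lt with rfl | hp1
  · exact ⟨Set.univ, isLowerSet_univ, by simp, by simp⟩
  obtain ⟨a, ha⟩ := ((tendsto_cdf_atBot μ).eventually_lt_const hp0).exists
  obtain ⟨b, hb⟩ := ((tendsto_cdf_atTop μ).eventually_const_lt hp1).exists
  obtain ⟨x, hx⟩ := mem_range_of_exists_le_of_exists_ge (continuous_cdf μ) ⟨a, ha.le⟩ ⟨b, hb.le⟩
  exact ⟨Set.Iic x, isLowerSet_Iic x, by simp, by rw [← cdf_eq_real, hx]⟩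

/-- Lower sets of a linear order form a chain, so a strict comparison of masses decides the
inclusion. -/
lemma IsLowerSet.measureReal_mono_of_lt {μ : Measure ℝ} [IsFiniteMeasure μ] {s t : Set ℝ}
    (hs : IsLowerSet s) (ht : IsLowerSet t) (h : μ.real s < μ.real t) : s ⊆ t := by
  refine (hs.total ht).resolve_right fun hts => ?_
  exact absurd (measureReal_mono (μ := μ) hts) (not_le.2 h)

/-- **Pólya's theorem**: weak convergence to a law without atoms is uniform over half-lines. -/
theorem eventually_forall_isLowerSet_abs_sub_le {ι : Type*} {l : Filter ι}
    {μs : ι → ProbabilityMeasure ℝ} {μ : ProbabilityMeasure ℝ} [NullSingletonClass (μ : Measure ℝ)]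
    (h : Tendsto μs l (𝓝 μ)) {ε : ℝ} (hε : 0 < ε) :
    ∀ᶠ i in l, ∀ s : Set ℝ, IsLowerSet s →
      |(μs i : Measure ℝ).real s - (μ : Measure ℝ).real s| ≤ ε := by
  -- A grid of quantile sets of mesh `1 / K < ε / 2`; the other `ε / 2` pays for convergence on the
  -- finitely many grid sets.
  obtain ⟨K, hK⟩ := exists_nat_gt (2 / ε)
  have hKpos : (0 : ℝ) < K := lt_trans (by positivity) hK
  have hKε : 1 / (K : ℝ) < ε / 2 := by
    rw [div_lt_iff₀ hε] at hK
    rw [div_lt_iff₀ hKpos]; linarith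
  have hq (j : Fin (K + 1)) : ∃ s : Set ℝ, IsLowerSet s ∧ (μ : Measure ℝ) (frontier s) = 0 ∧
      (μ : Measure ℝ).real s = j / K := by
    refine exists_isLowerSet_measureReal_eq _ (by positivity) ?_
    rw [div_le_one hKpos]
    exact_mod_cast Nat.lt_succ_iff.1 j.2
  choose L hL hL0 hLμ using hq
  have hconv (j : Fin (K + 1)) :
      ∀ᶠ i in l, |(μs i : Measure ℝ).real (L j) - (μ : Measure ℝ).real (L j)| < ε / 2 := by
    have h1 := ProbabilityMeasure.tendsto_measure_of_null_frontier_of_tendsto' h (hL0 j)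
    have h2 := (ENNReal.tendsto_toReal (measure_ne_top _ _)).comp h1
    exact (Metric.tendsto_nhds.1 h2) _ (half_pos hε)
  filter_upwards [eventually_all.2 hconv] with i hi s hs
  set p := (μ : Measure ℝ).real s with hp
  have hp0 : 0 ≤ p := measureReal_nonneg
  have hp1 : p ≤ 1 := measureReal_le_one
  rw [abs_le]
  constructor
  · rcases hp0.eq_or_lt with h0 | h0
    · rw [← h0]; linarith [measureReal_nonneg (μ := (μs i : Measure ℝ)) (s := s)]
    -- The last grid level strictly below `p`: strictness yields the inclusion in `s`, at a loss of
    -- at most `1 / K`.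
    have hc : 0 < ⌈p * K⌉₊ := Nat.ceil_pos.2 (by positivity)
    have hc1 : ⌈p * K⌉₊ ≤ K := Nat.ceil_le.2 (by nlinarith)
    have hc2 : ((⌈p * K⌉₊ - 1 : ℕ) : ℝ) = (⌈p * K⌉₊ : ℝ) - 1 := by
      rw [Nat.cast_sub hc]; simp
    let j : Fin (K + 1) := ⟨⌈p * K⌉₊ - 1, by omega⟩
    have hj : (μ : Measure ℝ).real (L j) = ((⌈p * K⌉₊ : ℝ) - 1) / K := by rw [hLμ, ← hc2]
    have hlt : (μ : Measure ℝ).real (L j) < p := by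
      rw [hj, div_lt_iff₀ hKpos]
      linarith [Nat.ceil_lt_add_one (show 0 ≤ p * K by positivity)]
    have hge : p - 1 / K ≤ (μ : Measure ℝ).real (L j) := by
      rw [hj, sub_div]
      have := Nat.le_ceil (p * K)
      rw [← le_div_iff₀ hKpos] at this
      linarith
    have hm := measureReal_mono (μ := (μs i : Measure ℝ))
      (IsLowerSet.measureReal_mono_of_lt (hL j) hs hlt)
    linarith [(abs_lt.1 (hi j)).1]
  · rcases hp1.eq_or_lt with h0 | h0
    · rw [h0]; linarith [measureReal_le_one (μ := (μs i : Measure ℝ)) (s := s)]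
    have hf : ⌊p * K⌋₊ < K := (Nat.floor_lt (by positivity)).2 (by nlinarith)
    let j : Fin (K + 1) := ⟨⌊p * K⌋₊ + 1, by omega⟩
    have hj : (μ : Measure ℝ).real (L j) = ((⌊p * K⌋₊ : ℝ) + 1) / K := by rw [hLμ]; simp [j]
    have hlt : p < (μ : Measure ℝ).real (L j) := by
      rw [hj, lt_div_iff₀ hKpos]
      exact Nat.lt_floor_add_one _
    have hge : (μ : Measure ℝ).real (L j) ≤ p + 1 / K := by
      rw [hj, add_div]
      have := Nat.floor_le (show 0 ≤ p * K by positivity)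
      rw [← div_le_iff₀ hKpos] at this
      linarith
    have hm := measureReal_mono (μ := (μs i : Measure ℝ))
      (IsLowerSet.measureReal_mono_of_lt hs (hL j) hlt)
    linarith [(abs_lt.1 (hi j)).2]

/-- Convergence in distribution to a law without atoms is uniform over intervals. -/
theorem eventually_forall_interval_abs_sub_le {ι : Type*} {l : Filter ι}
    {μs : ι → ProbabilityMeasure ℝ} {μ : ProbabilityMeasure ℝ} [NullSingletonClass (μ : Measure ℝ)]
    (h : Tendsto μs l (𝓝 μ)) {ε : ℝ} (hε : 0 < ε) :
    ∀ᶠ i in l, ∀ s t : Set ℝ, IsLowerSet s → IsLowerSet t →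
      |(μs i : Measure ℝ).real (s \ t) - (μ : Measure ℝ).real (s \ t)| ≤ ε := by
  filter_upwards [eventually_forall_isLowerSet_abs_sub_le h (half_pos hε)] with i hi s t hs ht
  rcases ht.total hs with hts | hst
  · have hm : MeasurableSet t := ht.ordConnected.measurableSet
    rw [measureReal_sdiff hts hm, measureReal_sdiff hts hm]
    have h1 := abs_le.1 (hi s hs)
    have h2 := abs_le.1 (hi t ht)
    rw [abs_le]
    constructor <;> linarith
  · simp [Set.sdiff_eq_empty.2 hst, hε.le]

/-- If `√n (T n - m)` is asymptotically normal with variance `v`, then `T n` is approximately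
normal with mean `m` and variance `v / n`. -/
theorem ApproxNormal.of_tendstoInDistribution {Ω : Type*} [MeasurableSpace Ω] {μ : Measure Ω}
    [IsProbabilityMeasure μ] {T : ℕ → Ω → ℝ} {m : ℝ} {v : ℝ≥0} (hv : v ≠ 0)
    (h : TendstoInDistribution (fun (n : ℕ) ω => √(n : ℝ) * (T n ω - m)) atTop
      (fun z : ℝ => z) (fun _ => μ) (gaussianReal 0 v)) :
    ApproxNormal μ T m fun n => v / n := by
  intro ε hε
  have hna : NullSingletonClass ((gaussianReal 0 v).map fun z : ℝ => z) := by
    rw [Measure.map_id']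
    exact nullSingletonClass_gaussianReal hv
  have hev := @eventually_forall_interval_abs_sub_le _ _ _
    ⟨_, Measure.isProbabilityMeasure_map h.aemeasurable_limit⟩ hna h.tendsto ε hε
  filter_upwards [hev, eventually_gt_atTop 0]
    with n hn hn0 a b
  have hpos : 0 < √(n : ℝ) := Real.sqrt_pos.2 (by exact_mod_cast hn0)
  have hsq : √(n : ℝ) ^ 2 = n := Real.sq_sqrt (by positivity)
  -- `u` undoes the normalization, so that `s \ t` below is the preimage of `[a, b]`; infinite
  -- endpoints need no separate case.
  let u : ℝ → ℝ := fun y => m + (√(n : ℝ))⁻¹ * y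
  have hu : Monotone u := fun y z hyz => by
    simp only [u]; gcongr
  have hum : Measurable u := by fun_prop
  let s : Set ℝ := {y | (u y : EReal) ≤ b}
  let t : Set ℝ := {y | (u y : EReal) < a}
  have hs : IsLowerSet s := fun y z hzy hy =>
    le_trans (EReal.coe_le_coe_iff.2 (hu hzy)) hy
  have ht : IsLowerSet t := fun y z hzy hy =>
    lt_of_le_of_lt (EReal.coe_le_coe_iff.2 (hu hzy)) hy
  have hst : MeasurableSet (s \ t) :=
    hs.ordConnected.measurableSet.diff ht.ordConnected.measurableSet
  have key := hn s t hs ht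
  have h1 : ((μ.map fun ω => √(n : ℝ) * (T n ω - m)).real (s \ t)) =
      μ.real {ω | a ≤ (T n ω : EReal) ∧ (T n ω : EReal) ≤ b} := by
    rw [map_measureReal_apply_of_aemeasurable (h.forall_aemeasurable n) hst]
    congr 1
    ext ω
    have : u (√(n : ℝ) * (T n ω - m)) = T n ω := by
      simp only [u]; field_simp; ring
    simp [s, t, this, and_comm]
  have h2 : ((gaussianReal 0 v).map (fun z : ℝ => z)).real (s \ t) =
      (gaussianReal m (v / n)).real {y : ℝ | a ≤ (y : EReal) ∧ (y : EReal) ≤ b} := by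
    have hg : gaussianReal m (v / n) = (gaussianReal 0 v).map u := by
      have : u = (fun y => m + y) ∘ fun y => (√(n : ℝ))⁻¹ * y := rfl
      rw [this, ← Measure.map_map (by fun_prop) (by fun_prop), gaussianReal_map_const_mul,
        gaussianReal_map_const_add]
      congr 1
      · simp
      · ext
        simp [hsq, div_eq_inv_mul]
    rw [Measure.map_id', hg, map_measureReal_apply hum]
    · congr 1
      ext y
      simp [s, t, and_comm]
    · exact (measurableSet_le measurable_const measurable_coe_real_ereal).inter
        (measurableSet_le measurable_coe_real_ereal measurable_const)
  simp only [ProbabilityMeasure.coe_mk] at key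
  rwa [h1, h2] at key

end MLE

/-! ### Calculus in the parameter, domination and measurability -/

namespace MLE

section Calculus

variable {f : ℝ → ℝ} {U : Set ℝ} {t : ℝ}

lemma _root_.ContDiffOn.hasDerivAt_of_isOpen (hf : ContDiffOn ℝ 2 f U) (hU : IsOpen U)
    (ht : t ∈ U) : HasDerivAt f (deriv f t) t :=
  ((hf.differentiableOn (by norm_num)).differentiableAt (hU.mem_nhds ht)).hasDerivAt

lemma _root_.ContDiffOn.contDiffOn_one_deriv (hf : ContDiffOn ℝ 2 f U) (hU : IsOpen U) :
    ContDiffOn ℝ 1 (deriv f) U :=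
  hf.deriv_of_isOpen hU (by norm_num)

lemma _root_.ContDiffOn.hasDerivAt_deriv_of_isOpen (hf : ContDiffOn ℝ 2 f U) (hU : IsOpen U)
    (ht : t ∈ U) : HasDerivAt (deriv f) (iteratedDeriv 2 f t) t := by
  rw [iteratedDeriv_succ, iteratedDeriv_one]
  exact (((hf.contDiffOn_one_deriv hU).differentiableOn (by norm_num)).differentiableAt
    (hU.mem_nhds ht)).hasDerivAt

lemma _root_.ContDiffOn.continuousOn_iteratedDeriv_two (hf : ContDiffOn ℝ 2 f U)
    (hU : IsOpen U) : ContinuousOn (iteratedDeriv 2 f) U := by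
  rw [iteratedDeriv_succ, iteratedDeriv_one]
  exact (hf.contDiffOn_one_deriv hU).continuousOn_deriv_of_isOpen hU (by norm_num)

lemma mul_deriv_log (hf : ContDiffOn ℝ 2 f U) (hU : IsOpen U) (hpos : ∀ t ∈ U, 0 < f t)
    (ht : t ∈ U) : f t * deriv (fun s => Real.log (f s)) t = deriv f t := by
  rw [((hf.hasDerivAt_of_isOpen hU ht).log (hpos t ht).ne').deriv,
    mul_div_cancel₀ _ (hpos t ht).ne']

/-- Differentiate the identity `f * (log f)' = f'` once more. The product form is the one to
integrate against `ν`. -/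
lemma mul_iteratedDeriv_two_log (hf : ContDiffOn ℝ 2 f U) (hU : IsOpen U)
    (hpos : ∀ t ∈ U, 0 < f t) (ht : t ∈ U) :
    f t * iteratedDeriv 2 (fun s => Real.log (f s)) t =
      iteratedDeriv 2 f t - f t * deriv (fun s => Real.log (f s)) t ^ 2 := by
  have hlog : ContDiffOn ℝ 2 (fun s => Real.log (f s)) U := hf.log fun t ht => (hpos t ht).ne'
  have h1 := (hf.hasDerivAt_of_isOpen hU ht).mul (hlog.hasDerivAt_deriv_of_isOpen hU ht)
  have h2 : f * deriv (fun s => Real.log (f s)) =ᶠ[𝓝 t] deriv f := by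
    filter_upwards [hU.mem_nhds ht] with s hs
    exact mul_deriv_log hf hU hpos hs
  have h3 := (h1.congr_of_eventuallyEq h2.symm).unique (hf.hasDerivAt_deriv_of_isOpen hU ht)
  rw [← h3, ← mul_deriv_log hf hU hpos ht]
  ring

/-- First-order expansion of the derivative, with error controlled by the oscillation of the
second derivative. -/
lemma abs_deriv_sub_le {θ δ η w : ℝ} (hf : ContDiffOn ℝ 2 f (Metric.ball θ δ)) (hη : η ≤ δ)
    (ht : t ∈ Metric.ball θ η)
    (hw : ∀ s ∈ Metric.ball θ η, |iteratedDeriv 2 f s - iteratedDeriv 2 f θ| ≤ w) :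
    |deriv f t - deriv f θ - (t - θ) * iteratedDeriv 2 f θ| ≤ w * |t - θ| := by
  have hθ : θ ∈ Metric.ball θ η := Metric.mem_ball_self (dist_nonneg.trans_lt ht)
  have h := (convex_ball θ η).norm_image_sub_le_of_norm_hasDerivWithin_le
    (f := fun s => deriv f s - s * iteratedDeriv 2 f θ)
    (f' := fun s => iteratedDeriv 2 f s - 1 * iteratedDeriv 2 f θ) (C := w) (fun s hs =>
      ((hf.hasDerivAt_deriv_of_isOpen Metric.isOpen_ball
        (Metric.ball_subset_ball hη hs)).sub
          ((hasDerivAt_id s).mul_const _)).hasDerivWithinAt)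
    (fun s hs => by simpa using hw s hs) hθ ht
  simp only [Real.norm_eq_abs] at h
  convert h using 2
  ring

end Calculus

variable {𝓧 : Type*} [MeasurableSpace 𝓧] {μ ν : Measure 𝓧}

/-- The derivative is an a.e. limit of difference quotients along one sequence, so no joint
measurability in parameter and observation is needed. -/
lemma aemeasurable_deriv_of_eventually {f : ℝ → 𝓧 → ℝ} {t : ℝ}
    (hf : ∀ᶠ s in 𝓝 t, AEMeasurable (f s) μ)
    (hd : ∀ᵐ x ∂μ, DifferentiableAt ℝ (fun s => f s x) t) :
    AEMeasurable (fun x => deriv (fun s => f s x) t) μ := by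
  have hu : Tendsto (fun n : ℕ => t + 1 / ((n : ℝ) + 1)) atTop (𝓝[≠] t) := by
    refine tendsto_nhdsWithin_iff.2 ⟨?_, Eventually.of_forall fun n => ?_⟩
    · simpa using tendsto_one_div_add_atTop_nhds_zero_nat.const_add t
    · have : (0 : ℝ) < 1 / ((n : ℝ) + 1) := by positivity
      simpa using by positivity
  obtain ⟨N, hN⟩ := eventually_atTop.1 ((hu.mono_right nhdsWithin_le_nhds).eventually hf)
  have hu' := hu.comp (tendsto_add_atTop_nat N)
  refine aemeasurable_of_tendsto_metrizable_ae atTop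
    (f := fun n x => slope (fun s => f s x) t (t + 1 / (((n + N : ℕ) : ℝ) + 1))) (fun n => ?_) ?_
  · simp only [slope_def_field]
    exact ((hN _ (Nat.le_add_left _ _)).sub hf.self_of_nhds).div_const _
  · filter_upwards [hd] with x hx
    exact (hasDerivAt_iff_tendsto_slope.1 hx.hasDerivAt).comp hu'

/-- Differentiation under the integral sign for a family with constant integral. -/
lemma integral_deriv_eq_zero {f : ℝ → 𝓧 → ℝ} {U : Set ℝ} {c : ℝ} {g : 𝓧 → ℝ} (hU : IsOpen U)
    (hint : ∀ t ∈ U, Integrable (f t) ν) (hc : ∀ t ∈ U, ∫ x, f t x ∂ν = c)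
    (hdiff : ∀ᵐ x ∂ν, ∀ t ∈ U, DifferentiableAt ℝ (fun s => f s x) t) (hg : Integrable g ν)
    (hbound : ∀ᵐ x ∂ν, ∀ t ∈ U, |deriv (fun s => f s x) t| ≤ g x) {t : ℝ} (ht : t ∈ U) :
    Integrable (fun x => deriv (fun s => f s x) t) ν ∧
      ∫ x, deriv (fun s => f s x) t ∂ν = 0 := by
  have hUt := hU.mem_nhds ht
  have hmeas : ∀ᶠ s in 𝓝 t, AEMeasurable (f s) ν := by
    filter_upwards [hUt] with s hs using (hint s hs).aemeasurable
  have h := hasDerivAt_integral_of_dominated_loc_of_deriv_le (μ := ν) (F := f)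
    (F' := fun s x => deriv (fun r => f r x) s) (bound := g) hUt
    (hmeas.mono fun s hs => hs.aestronglyMeasurable) (hint t ht)
    (aemeasurable_deriv_of_eventually hmeas
      (hdiff.mono fun x hx => hx t ht)).aestronglyMeasurable
    hbound hg (hdiff.mono fun x hx s hs => (hx s hs).hasDerivAt)
  refine ⟨h.1, h.2.unique ?_⟩
  refine (hasDerivAt_const t c).congr_of_eventuallyEq ?_
  filter_upwards [hUt] with s hs using hc s hs

/-- For functions of class `C²` in the parameter with second derivatives dominated by an
integrable function, the oscillation of the second derivative near a point is bounded by a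
function of small integral. -/
lemma exists_integrable_oscillation_bound {f : ℝ → 𝓧 → ℝ} {θ δ : ℝ} (hδ : 0 < δ) {H : 𝓧 → ℝ}
    (hmeas : ∀ t ∈ Metric.ball θ δ, AEMeasurable (f t) μ)
    (hdiff : ∀ᵐ x ∂μ, ContDiffOn ℝ 2 (fun t => f t x) (Metric.ball θ δ)) (hH : Integrable H μ)
    (hbound : ∀ᵐ x ∂μ, ∀ t ∈ Metric.ball θ δ, |iteratedDeriv 2 (fun s => f s x) t| ≤ H x)
    {ε : ℝ} (hε : 0 < ε) :
    ∃ η, 0 < η ∧ η ≤ δ ∧ ∃ w : 𝓧 → ℝ, Integrable w μ ∧ ∫ x, w x ∂μ < ε ∧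
      ∀ᵐ x ∂μ, ∀ t ∈ Metric.ball θ η,
        |iteratedDeriv 2 (fun s => f s x) t - iteratedDeriv 2 (fun s => f s x) θ| ≤ w x := by
  have hopen : IsOpen (Metric.ball θ δ) := Metric.isOpen_ball
  have hθ : θ ∈ Metric.ball θ δ := Metric.mem_ball_self hδ
  have hm1 : ∀ t ∈ Metric.ball θ δ, AEMeasurable (fun x => deriv (fun s => f s x) t) μ :=
    fun t ht => aemeasurable_deriv_of_eventually
      (by filter_upwards [hopen.mem_nhds ht] with s hs using hmeas s hs)
      (hdiff.mono fun x hx => (hx.hasDerivAt_of_isOpen hopen ht).differentiableAt)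
  have hm2 : ∀ t ∈ Metric.ball θ δ,
      AEMeasurable (fun x => iteratedDeriv 2 (fun s => f s x) t) μ := fun t ht => by
    simp only [iteratedDeriv_succ, iteratedDeriv_zero]
    exact aemeasurable_deriv_of_eventually
      (by filter_upwards [hopen.mem_nhds ht] with s hs using hm1 s hs)
      (hdiff.mono fun x hx => (hx.hasDerivAt_deriv_of_isOpen hopen ht).differentiableAt)
  let D : ℝ → 𝓧 → ℝ≥0∞ := fun t x =>
    ‖iteratedDeriv 2 (fun s => f s x) t - iteratedDeriv 2 (fun s => f s x) θ‖ₑ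
  let r : ℕ → ℝ := fun n => δ / (n + 1)
  have hr (n : ℕ) : 0 < r n := by positivity
  have hrδ (n : ℕ) : r n ≤ δ := div_le_self hδ.le (by simp)
  have hr0 : Tendsto r atTop (𝓝 0) := by
    simpa [r, div_eq_mul_inv] using tendsto_one_div_add_atTop_nhds_zero_nat.const_mul δ
  -- Restricting the supremum to rational parameters keeps it measurable; continuity of the second
  -- derivative recovers all real ones at the end.
  let W : ℕ → 𝓧 → ℝ≥0∞ := fun n x => ⨆ (q : ℚ), ⨆ (_ : (q : ℝ) ∈ Metric.ball θ (r n)), D q x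
  have hWm (n : ℕ) : AEMeasurable (W n) μ := by
    refine AEMeasurable.iSup fun q => AEMeasurable.iSup fun hq => ?_
    exact ((hm2 q (Metric.ball_subset_ball (hrδ n) hq)).sub (hm2 θ hθ)).enorm
  have hWle : ∀ᵐ x ∂μ, ∀ n, W n x ≤ ENNReal.ofReal (2 * H x) := by
    filter_upwards [hbound] with x hx n
    refine iSup₂_le fun q hq => ?_
    simp only [D, ← ofReal_norm]
    refine ENNReal.ofReal_le_ofReal ((norm_sub_le _ _).trans ?_)
    have h1 := hx q (Metric.ball_subset_ball (hrδ n) hq)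
    have h2 := hx θ hθ
    simp only [Real.norm_eq_abs]
    linarith
  have hHfin : ∫⁻ x, ENNReal.ofReal (2 * H x) ∂μ ≠ ∞ :=
    (hH.const_mul 2).lintegral_lt_top.ne
  have hlim : Tendsto (fun n => ∫⁻ x, W n x ∂μ) atTop (𝓝 (∫⁻ _, 0 ∂μ)) := by
    refine tendsto_lintegral_of_dominated_convergence' (fun x => ENNReal.ofReal (2 * H x)) hWm
      (fun n => hWle.mono fun x hx => hx n) hHfin ?_
    filter_upwards [hdiff] with x hx
    rw [ENNReal.tendsto_nhds_zero]
    intro e he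
    have hcont : ContinuousAt (fun t => D t x) θ :=
      (((hx.continuousOn_iteratedDeriv_two hopen).continuousAt (hopen.mem_nhds hθ)).sub
        continuousAt_const).enorm
    have hD0 : D θ x = 0 := by simp [D]
    have hev : ∀ᶠ t in 𝓝 θ, D t x < e := hcont.eventually_lt_const (by simpa only [hD0] using he)
    obtain ⟨ρ, hρ, hball⟩ := Metric.eventually_nhds_iff_ball.1 hev
    filter_upwards [hr0.eventually_lt_const hρ] with n hn
    exact iSup₂_le fun q hq => (hball q (Metric.ball_subset_ball hn.le hq)).le
  rw [lintegral_zero] at hlim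
  obtain ⟨n, hn⟩ := (hlim.eventually_lt_const (ENNReal.ofReal_pos.2 hε)).exists
  refine ⟨r n, hr n, hrδ n, fun x => (W n x).toReal, ?_, ?_, ?_⟩
  · exact integrable_toReal_of_lintegral_ne_top (hWm n) hn.ne_top
  · rw [integral_toReal (hWm n) (hWle.mono fun x hx => (hx n).trans_lt ENNReal.ofReal_lt_top)]
    exact ENNReal.toReal_lt_of_lt_ofReal hn
  · filter_upwards [hdiff, hWle] with x hx hxW t ht
    have hfin : W n x ≠ ∞ := ((hxW n).trans_lt ENNReal.ofReal_lt_top).ne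
    suffices D t x ≤ W n x by
      have h := ENNReal.toReal_mono hfin this
      simpa [D, toReal_enorm] using h
    have hcont : ContinuousOn (fun t => D t x) (Metric.ball θ (r n)) :=
      (((hx.continuousOn_iteratedDeriv_two hopen).mono (Metric.ball_subset_ball (hrδ n))).sub
        continuousOn_const).enorm
    have hne : (𝓝[Metric.ball θ (r n) ∩ Set.range ((↑) : ℚ → ℝ)] t).NeBot :=
      mem_closure_iff_nhdsWithin_neBot.1
        (Rat.denseRange_cast.open_subset_closure_inter Metric.isOpen_ball ht)
    refine le_of_tendsto (x := 𝓝[Metric.ball θ (r n) ∩ Set.range ((↑) : ℚ → ℝ)] t)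
      ((hcont t ht).mono_left (nhdsWithin_mono t Set.inter_subset_left)) ?_
    filter_upwards [self_mem_nhdsWithin] with s hs
    obtain ⟨hs, q, rfl⟩ := hs
    exact le_iSup₂ (f := fun (q : ℚ) (_ : (q : ℝ) ∈ Metric.ball θ (r n)) => D q x) q hs

end MLE

/-! ### Likelihood, score and Fisher information -/

namespace MLE

section Pointwise

variable {𝓧 : Type*} {Θ : Set ℝ} {ψ : ℝ → 𝓧 → ℝ} {t θ δ : ℝ}

/-- `x` is a point at which the likelihood is positive and of class `C²` near `θ`. -/
def IsRegularPoint (ψ : ℝ → 𝓧 → ℝ) (θ δ : ℝ) (x : 𝓧) : Prop :=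
  (∀ t ∈ Metric.ball θ δ, 0 < ψ t x) ∧ ContDiffOn ℝ 2 (fun t => ψ t x) (Metric.ball θ δ)

lemma IsRegularPoint.contDiffOn_log {x : 𝓧} (hx : IsRegularPoint ψ θ δ x) :
    ContDiffOn ℝ 2 (fun t => Real.log (ψ t x)) (Metric.ball θ δ) :=
  hx.2.log fun t ht => (hx.1 t ht).ne'

lemma logLikelihood_eq_sum {n : ℕ} {x : Fin n → 𝓧} (hx : ∀ j, IsRegularPoint ψ θ δ (x j))
    (ht : t ∈ Metric.ball θ δ) :
    logLikelihood ψ n x t = ∑ j, Real.log (ψ t (x j)) :=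
  Real.log_prod fun j _ => ((hx j).1 t ht).ne'

/-- The score is the sum of the scores of the single observations. -/
lemma score_eq_sum {n : ℕ} {x : Fin n → 𝓧} (hx : ∀ j, IsRegularPoint ψ θ δ (x j))
    (ht : t ∈ Metric.ball θ δ) :
    score ψ n t x = ∑ j, deriv (fun s => Real.log (ψ s (x j))) t := by
  have h : logLikelihood ψ n x =ᶠ[𝓝 t] fun s => ∑ j, Real.log (ψ s (x j)) := by
    filter_upwards [Metric.isOpen_ball.mem_nhds ht] with s hs using logLikelihood_eq_sum hx hs
  rw [score, h.deriv_eq, deriv_fun_sum fun j _ =>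
    ((hx j).contDiffOn_log.hasDerivAt_of_isOpen Metric.isOpen_ball ht).differentiableAt]

/-- The likelihood equation: the score vanishes at an interior maximum likelihood estimate. -/
lemma IsMaxLikelihood.score_eq_zero {n : ℕ} {x : Fin n → 𝓧} (hΘ : Metric.ball θ δ ⊆ Θ)
    (hx : ∀ j, IsRegularPoint ψ θ δ (x j)) (ht : t ∈ Metric.ball θ δ)
    (hmax : IsMaxLikelihood Θ ψ n x t) : score ψ n t x = 0 := by
  have h : IsLocalMax (logLikelihood ψ n x) t := by
    filter_upwards [Metric.isOpen_ball.mem_nhds ht] with s hs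
    exact Real.log_le_log (Finset.prod_pos fun j _ => (hx j).1 s hs) (hmax.2 (hΘ hs))
  exact h.deriv_eq_zero

/-- The score of one observation. -/
noncomputable def obsScore (ψ : ℝ → 𝓧 → ℝ) (t : ℝ) (x : 𝓧) : ℝ :=
  deriv (fun s => Real.log (ψ s x)) t

/-- The derivative of the score of one observation. -/
noncomputable def obsScoreDeriv (ψ : ℝ → 𝓧 → ℝ) (t : ℝ) (x : 𝓧) : ℝ :=
  iteratedDeriv 2 (fun s => Real.log (ψ s x)) t

end Pointwise

variable {𝓧 : Type*} [MeasurableSpace 𝓧] {ν : Measure 𝓧} {Θ : Set ℝ} {ψ : ℝ → 𝓧 → ℝ} {t θ δ : ℝ}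

lemma IsDensityFamily.isProbabilityMeasure_obsLaw (h : IsDensityFamily ν Θ ψ) (ht : t ∈ Θ) :
    IsProbabilityMeasure (obsLaw ν ψ t) :=
  ⟨by rw [obsLaw, withDensity_apply _ .univ, Measure.restrict_univ, h.lintegral_eq_one t ht]⟩

lemma IsDensityFamily.integral_obsLaw (h : IsDensityFamily ν Θ ψ) (ht : t ∈ Θ) (g : 𝓧 → ℝ) :
    ∫ x, g x ∂obsLaw ν ψ t = ∫ x, ψ t x * g x ∂ν := by
  rw [obsLaw, integral_withDensity_eq_integral_toReal_smul (h.measurable t ht).ennreal_ofReal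
    (by simp)]
  simp [ENNReal.toReal_ofReal (h.nonneg t ht _)]

lemma IsDensityFamily.integrable_obsLaw_iff (h : IsDensityFamily ν Θ ψ) (ht : t ∈ Θ)
    (g : 𝓧 → ℝ) : Integrable g (obsLaw ν ψ t) ↔ Integrable (fun x => ψ t x * g x) ν := by
  rw [obsLaw, integrable_withDensity_iff_integrable_smul' (h.measurable t ht).ennreal_ofReal
    (by simp)]
  simp [ENNReal.toReal_ofReal (h.nonneg t ht _)]

lemma IsDensityFamily.integrable (h : IsDensityFamily ν Θ ψ) (ht : t ∈ Θ) :
    Integrable (ψ t) ν := by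
  have := h.isProbabilityMeasure_obsLaw ht
  simpa using (h.integrable_obsLaw_iff ht fun _ => 1).1 (integrable_const _)

lemma IsDensityFamily.integral_eq_one (h : IsDensityFamily ν Θ ψ) (ht : t ∈ Θ) :
    ∫ x, ψ t x ∂ν = 1 := by
  have := h.isProbabilityMeasure_obsLaw ht
  simpa using (h.integral_obsLaw ht fun _ => 1).symm

lemma obsLaw_absolutelyContinuous : obsLaw ν ψ t ≪ ν :=
  withDensity_absolutelyContinuous _ _

/-- Differentiates `∫ ψ_t = 1`. It is needed on the whole ball, not only at `θ`, so that the result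
can be differentiated again. -/
lemma integral_deriv_density (h : IsDensityFamily ν Θ ψ) (hΘ : Metric.ball θ δ ⊆ Θ)
    (hreg : ∀ᵐ x ∂ν, IsRegularPoint ψ θ δ x) {g : 𝓧 → ℝ} (hg : Integrable g ν)
    (hbound : ∀ᵐ x ∂ν, ∀ t ∈ Metric.ball θ δ, |deriv (fun s => ψ s x) t| ≤ g x)
    (ht : t ∈ Metric.ball θ δ) :
    Integrable (fun x => deriv (fun s => ψ s x) t) ν ∧ ∫ x, deriv (fun s => ψ s x) t ∂ν = 0 :=
  integral_deriv_eq_zero Metric.isOpen_ball (fun _ ht => h.integrable (hΘ ht))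
    (fun _ ht => h.integral_eq_one (hΘ ht))
    (hreg.mono fun _ hx _ ht => (hx.2.hasDerivAt_of_isOpen Metric.isOpen_ball ht).differentiableAt)
    hg hbound ht

section Moments

variable (h : IsDensityFamily ν Θ ψ) (hδ : 0 < δ) (hΘ : Metric.ball θ δ ⊆ Θ)
  (hreg : ∀ᵐ x ∂ν, IsRegularPoint ψ θ δ x)

include h hδ hΘ hreg

lemma aemeasurable_obsScore : AEMeasurable (obsScore ψ θ) ν := by
  have hθ := Metric.mem_ball_self (x := θ) hδ
  refine aemeasurable_deriv_of_eventually ?_ ?_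
  · filter_upwards [Metric.isOpen_ball.mem_nhds hθ] with s hs
    exact ((h.measurable s (hΘ hs)).log).aemeasurable
  · filter_upwards [hreg] with x hx
    exact (hx.contDiffOn_log.hasDerivAt_of_isOpen Metric.isOpen_ball hθ).differentiableAt

lemma ae_pi_isRegularPoint (n : ℕ) :
    ∀ᵐ x ∂(Measure.pi fun _ : Fin n => obsLaw ν ψ θ), ∀ j, IsRegularPoint ψ θ δ (x j) := by
  have := h.isProbabilityMeasure_obsLaw (hΘ (Metric.mem_ball_self hδ))
  rw [ae_all_iff]
  intro j
  exact (Measure.quasiMeasurePreserving_eval (fun _ : Fin n => obsLaw ν ψ θ) j).ae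
    (obsLaw_absolutelyContinuous.ae_le hreg)

lemma fisherInfo_eq_variance_sum (n : ℕ) :
    fisherInfo ν ψ n θ =
      Var[∑ j, fun x => obsScore ψ θ (x j); Measure.pi fun _ : Fin n => obsLaw ν ψ θ] := by
  refine variance_congr ?_
  filter_upwards [ae_pi_isRegularPoint h hδ hΘ hreg n] with x hx
  rw [score_eq_sum hx (Metric.mem_ball_self hδ)]
  simp [obsScore]

lemma fisherInfo_one : fisherInfo ν ψ 1 θ = Var[obsScore ψ θ; obsLaw ν ψ θ] := by
  have := h.isProbabilityMeasure_obsLaw (hΘ (Metric.mem_ball_self hδ))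
  have hmp := measurePreserving_eval (fun _ : Fin 1 => obsLaw ν ψ θ) 0
  have hae : AEMeasurable (obsScore ψ θ) (obsLaw ν ψ θ) :=
    (aemeasurable_obsScore h hδ hΘ hreg).mono_ac obsLaw_absolutelyContinuous
  rw [fisherInfo_eq_variance_sum h hδ hΘ hreg]
  conv_rhs => rw [← hmp.map_eq]
  rw [variance_map (by rwa [hmp.map_eq]) hmp.measurable.aemeasurable]
  simp [Function.comp_def]

/-- The variance of a function outside `L²` takes the default value `0`, so positive Fisher
information already forces square integrability. -/
lemma memLp_obsScore (hF : 0 < fisherInfo ν ψ 1 θ) : MemLp (obsScore ψ θ) 2 (obsLaw ν ψ θ) := by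
  have := h.isProbabilityMeasure_obsLaw (hΘ (Metric.mem_ball_self hδ))
  rw [fisherInfo_one h hδ hΘ hreg] at hF
  exact memLp_two_of_variance_ne_zero ((aemeasurable_obsScore h hδ hΘ hreg).mono_ac
    obsLaw_absolutelyContinuous).aestronglyMeasurable hF.ne'

/-- Additivity of the Fisher information. -/
lemma fisherInfo_eq_mul (hF : 0 < fisherInfo ν ψ 1 θ) (n : ℕ) :
    fisherInfo ν ψ n θ = n * fisherInfo ν ψ 1 θ := by
  have := h.isProbabilityMeasure_obsLaw (hΘ (Metric.mem_ball_self hδ))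
  rw [fisherInfo_eq_variance_sum h hδ hΘ hreg n, fisherInfo_one h hδ hΘ hreg,
    variance_sum_pi fun _ => memLp_obsScore h hδ hΘ hreg hF]
  simp

variable {g : 𝓧 → ℝ} (hg : Integrable g ν) (hbound : ∀ᵐ x ∂ν, ∀ t ∈ Metric.ball θ δ,
  |deriv (fun s => ψ s x) t| ≤ g x ∧ |iteratedDeriv 2 (fun s => ψ s x) t| ≤ g x)

include hg hbound

lemma integral_iteratedDeriv_density :
    Integrable (fun x => iteratedDeriv 2 (fun s => ψ s x) θ) ν ∧
      ∫ x, iteratedDeriv 2 (fun s => ψ s x) θ ∂ν = 0 := by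
  have hd := fun t ht => integral_deriv_density (t := t) h hΘ hreg hg
    (hbound.mono fun x hx t ht => (hx t ht).1) ht
  have := integral_deriv_eq_zero (f := fun t x => deriv (fun s => ψ s x) t) (c := 0)
    Metric.isOpen_ball (fun t ht => (hd t ht).1) (fun t ht => (hd t ht).2)
    (hreg.mono fun x hx t ht =>
      (hx.2.hasDerivAt_deriv_of_isOpen Metric.isOpen_ball ht).differentiableAt) hg
    (by simpa only [iteratedDeriv_succ, iteratedDeriv_zero] using
      hbound.mono fun x hx t ht => (hx t ht).2) (Metric.mem_ball_self hδ)
  simpa only [iteratedDeriv_succ, iteratedDeriv_zero] using this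

/-- The score is centred. -/
lemma integral_obsScore : ∫ x, obsScore ψ θ x ∂obsLaw ν ψ θ = 0 := by
  have hθ := Metric.mem_ball_self (x := θ) hδ
  rw [h.integral_obsLaw (hΘ hθ), ← (integral_deriv_density h hΘ hreg hg
    (hbound.mono fun x hx t ht => (hx t ht).1) hθ).2]
  refine integral_congr_ae ?_
  filter_upwards [hreg] with x hx using mul_deriv_log hx.2 Metric.isOpen_ball hx.1 hθ

/-- The information identity. -/
lemma integral_obsScoreDeriv (hF : 0 < fisherInfo ν ψ 1 θ) :
    Integrable (obsScoreDeriv ψ θ) (obsLaw ν ψ θ) ∧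
      ∫ x, obsScoreDeriv ψ θ x ∂obsLaw ν ψ θ = -fisherInfo ν ψ 1 θ := by
  have hθ := Metric.mem_ball_self (x := θ) hδ
  have := h.isProbabilityMeasure_obsLaw (hΘ hθ)
  have hL := memLp_obsScore h hδ hΘ hreg hF
  have hI2 := integral_iteratedDeriv_density h hδ hΘ hreg hg hbound
  have hsq : Integrable (fun x => ψ θ x * obsScore ψ θ x ^ 2) ν :=
    (h.integrable_obsLaw_iff (hΘ hθ) _).1 hL.integrable_sq
  have hae : (fun x => iteratedDeriv 2 (fun s => ψ s x) θ - ψ θ x * obsScore ψ θ x ^ 2) =ᵐ[ν]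
      fun x => ψ θ x * obsScoreDeriv ψ θ x := by
    filter_upwards [hreg] with x hx
    exact (mul_iteratedDeriv_two_log hx.2 Metric.isOpen_ball hx.1 hθ).symm
  refine ⟨(h.integrable_obsLaw_iff (hΘ hθ) _).2 ((hI2.1.sub hsq).congr hae), ?_⟩
  rw [h.integral_obsLaw (hΘ hθ), ← integral_congr_ae hae, integral_sub hI2.1 hsq, hI2.2,
    zero_sub, ← h.integral_obsLaw (hΘ hθ), fisherInfo_one h hδ hΘ hreg,
    variance_of_integral_eq_zero hL.aestronglyMeasurable.aemeasurable
      (integral_obsScore h hδ hΘ hreg hg hbound)]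

end Moments

end MLE

/-! ### Limit theorems for i.i.d. observations and asymptotic linearity -/

namespace MLE

section IID

variable {Ω 𝓧 : Type*} [MeasurableSpace Ω] [MeasurableSpace 𝓧] {μ : Measure Ω}
  {X : ℕ → Ω → 𝓧} {Q : Measure 𝓧} {g : 𝓧 → ℝ}

lemma iIndepFun_comp_of_law (hX : ∀ j, Measurable (X j)) (hind : iIndepFun X μ)
    (hlaw : ∀ j, μ.map (X j) = Q) (hg : AEMeasurable g Q) :
    iIndepFun (fun j ω => g (X j ω)) μ :=
  hind.comp₀ (fun _ => g) (fun j => (hX j).aemeasurable) fun j => by rwa [hlaw j]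

lemma identDistrib_comp_of_law (hX : ∀ j, Measurable (X j)) (hlaw : ∀ j, μ.map (X j) = Q)
    (hg : AEMeasurable g Q) (i j : ℕ) :
    IdentDistrib (fun ω => g (X i ω)) (fun ω => g (X j ω)) μ μ := by
  have h : IdentDistrib (X i) (X j) μ μ :=
    ⟨(hX i).aemeasurable, (hX j).aemeasurable, (hlaw i).trans (hlaw j).symm⟩
  exact h.comp_of_aemeasurable (u := g) (by rwa [hlaw i])

lemma measurePreserving_of_law (hX : ∀ j, Measurable (X j)) (hlaw : ∀ j, μ.map (X j) = Q)
    (j : ℕ) : MeasurePreserving (X j) μ Q := ⟨hX j, hlaw j⟩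

/-- The law of large numbers for a function of i.i.d. observations. -/
lemma tendstoInMeasure_sum_div [IsProbabilityMeasure μ] (hX : ∀ j, Measurable (X j))
    (hind : iIndepFun X μ) (hlaw : ∀ j, μ.map (X j) = Q) (hg : Integrable g Q) :
    TendstoInMeasure μ (fun (n : ℕ) ω => (∑ i ∈ Finset.range n, g (X i ω)) / n) atTop
      fun _ => ∫ x, g x ∂Q := by
  have hmp := measurePreserving_of_law hX hlaw
  have hae : AEMeasurable g Q := hg.aemeasurable
  have hint (j : ℕ) : Integrable (fun ω => g (X j ω)) μ := (hmp j).integrable_comp_of_integrable hg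
  have hmean : ∫ ω, g (X 0 ω) ∂μ = ∫ x, g x ∂Q := by
    rw [← hlaw 0, integral_map (hX 0).aemeasurable (by rw [hlaw 0]; exact hg.aestronglyMeasurable)]
  rw [← hmean]
  refine tendstoInMeasure_of_tendsto_ae (fun n => ?_) (strong_law_ae_real
    (fun j ω => g (X j ω)) (hint 0)
    (fun i j hij => (iIndepFun_comp_of_law hX hind hlaw hae).indepFun hij)
    fun i => identDistrib_comp_of_law hX hlaw hae i 0)
  exact ((Finset.aemeasurable_fun_sum _ fun i _ => (hint i).aemeasurable).div_const
    _).aestronglyMeasurable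

/-- The central limit theorem for a centred function of i.i.d. observations. -/
lemma tendstoInDistribution_sum [IsProbabilityMeasure μ] (hX : ∀ j, Measurable (X j))
    (hind : iIndepFun X μ) (hlaw : ∀ j, μ.map (X j) = Q) (hg : MemLp g 2 Q)
    (hg0 : ∫ x, g x ∂Q = 0) :
    TendstoInDistribution (fun (n : ℕ) ω => (√(n : ℝ))⁻¹ * ∑ i ∈ Finset.range n, g (X i ω)) atTop
      (fun z : ℝ => z) (fun _ => μ) (gaussianReal 0 Var[g; Q].toNNReal) := by
  have hae : AEMeasurable g Q := hg.aestronglyMeasurable.aemeasurable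
  have hmean : ∫ ω, g (X 0 ω) ∂μ = 0 := by
    rw [← hg0, ← hlaw 0, integral_map (hX 0).aemeasurable
      (by rw [hlaw 0]; exact hg.aestronglyMeasurable)]
  have hvar : Var[fun ω => g (X 0 ω); μ] = Var[g; Q] := by
    rw [← hlaw 0, variance_map (by rwa [hlaw 0]) (hX 0).aemeasurable]
    rfl
  have h := tendstoInDistribution_inv_sqrt_mul_sum_sub (P := μ) (X := fun j ω => g (X j ω))
    (Y := fun z : ℝ => z) (P' := gaussianReal 0 Var[g; Q].toNNReal)
    (by rw [hvar]; exact HasLaw.id)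
    (hg.comp_measurePreserving (measurePreserving_of_law hX hlaw 0))
    (iIndepFun_comp_of_law hX hind hlaw hae)
    (fun i => identDistrib_comp_of_law hX hlaw hae i 0)
  simpa only [hmean, mul_zero, sub_zero] using h

/-- Chebyshev's inequality for the normalized sum of a centred function of i.i.d. observations. -/
lemma measure_le_abs_sum_le [IsProbabilityMeasure μ] (hX : ∀ j, Measurable (X j))
    (hind : iIndepFun X μ) (hlaw : ∀ j, μ.map (X j) = Q) (hg : MemLp g 2 Q)
    (hg0 : ∫ x, g x ∂Q = 0) (n : ℕ) {M : ℝ} (hM : 0 < M) :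
    μ {ω | M ≤ |(√(n : ℝ))⁻¹ * ∑ i ∈ Finset.range n, g (X i ω)|} ≤
      ENNReal.ofReal (Var[g; Q] / M ^ 2) := by
  have hae : AEMeasurable g Q := hg.aestronglyMeasurable.aemeasurable
  have hL (j : ℕ) : MemLp (fun ω => g (X j ω)) 2 μ :=
    hg.comp_measurePreserving (measurePreserving_of_law hX hlaw j)
  have hmean (j : ℕ) : ∫ ω, g (X j ω) ∂μ = 0 := by
    rw [← hg0, ← hlaw j, integral_map (hX j).aemeasurable
      (by rw [hlaw j]; exact hg.aestronglyMeasurable)]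
  have hvar (j : ℕ) : Var[fun ω => g (X j ω); μ] = Var[g; Q] := by
    rw [← hlaw j, variance_map (by rwa [hlaw j]) (hX j).aemeasurable]
    rfl
  have hsum : MemLp (fun ω => ∑ i ∈ Finset.range n, g (X i ω)) 2 μ :=
    memLp_finsetSum _ fun i _ => hL i
  have hvsum : Var[fun ω => ∑ i ∈ Finset.range n, g (X i ω); μ] = n * Var[g; Q] := by
    have := IndepFun.variance_sum (s := Finset.range n) (fun i _ => hL i)
      fun i _ j _ hij => (iIndepFun_comp_of_law hX hind hlaw hae).indepFun hij
    simp only [hvar, Finset.sum_const, Finset.card_range, nsmul_eq_mul] at this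
    rw [← this]
    congr 1
    ext ω
    simp
  have h := meas_ge_le_variance_div_sq
    (hsum.const_mul (√(n : ℝ))⁻¹) hM
  have h0 : ∫ ω, (√(n : ℝ))⁻¹ * ∑ i ∈ Finset.range n, g (X i ω) ∂μ = 0 := by
    rw [integral_const_mul, integral_finsetSum _ fun i _ => (hL i).integrable (by norm_num)]
    simp [hmean]
  rw [h0, variance_const_mul, hvsum] at h
  simp only [sub_zero] at h
  refine h.trans (ENNReal.ofReal_le_ofReal ?_)
  gcongr
  rw [inv_pow, Real.sq_sqrt (by positivity)]
  -- For `n = 0` the factor `(√0)⁻¹` is `0` and only nonnegativity of the variance remains;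
  -- otherwise equality holds.
  rcases n.eq_zero_or_pos with rfl | hn
  · simp
  · field_simp
    exact le_rfl

end IID

/-- If `I * D n` agrees with the tight sequence `Z n` up to an error of smaller order than `D n`,
then `D n - Z n / I` tends to zero in probability. -/
lemma tendstoInMeasure_sub_of_asymptotically_linear {Ω : Type*} [MeasurableSpace Ω]
    {μ : Measure Ω} {D Z : ℕ → Ω → ℝ} {I V : ℝ} (hI : 0 < I)
    (hZ : ∀ n M, 0 < M → μ {ω | M ≤ |Z n ω|} ≤ ENNReal.ofReal (V / M ^ 2))
    (h : ∀ ε > 0, Tendsto (fun n => μ {ω | ε * |D n ω| < |I * D n ω - Z n ω|}) atTop (𝓝 0)) :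
    TendstoInMeasure μ (fun n ω => D n ω - I⁻¹ * Z n ω) atTop 0 := by
  rw [tendstoInMeasure_iff_norm]
  intro r hr
  rw [ENNReal.tendsto_nhds_zero]
  intro e he
  have hlim : Tendsto (fun M : ℝ => ENNReal.ofReal (V / M ^ 2)) atTop (𝓝 0) := by
    have := ENNReal.tendsto_ofReal
      ((tendsto_const_nhds (x := V)).div_atTop (tendsto_pow_atTop (two_ne_zero (α := ℕ))))
    simpa using this
  have he2 : 0 < e / 2 := ENNReal.half_pos he.ne'
  obtain ⟨M, hMe, hM⟩ := ((ENNReal.tendsto_nhds_zero.1 hlim _ he2).and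
    (eventually_gt_atTop (0 : ℝ))).exists
  -- The first bound absorbs `ε * |D|` into `I * |D|` and gives `|D| ≤ 2 * M / I`; the second then
  -- makes the error at most `r * I / 2`, hence less than `r` after division by `I`.
  let ε := min (I / 2) (r * I ^ 2 / (4 * M))
  have hε : 0 < ε := by positivity
  filter_upwards [ENNReal.tendsto_nhds_zero.1 (h ε hε) _ he2] with n hn
  calc μ {ω | r ≤ ‖(D n ω - I⁻¹ * Z n ω) - (0 : Ω → ℝ) ω‖}
      ≤ μ ({ω | ε * |D n ω| < |I * D n ω - Z n ω|} ∪ {ω | M ≤ |Z n ω|}) := by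
        refine measure_mono fun ω hω => ?_
        by_contra hcon
        simp only [Set.mem_union, Set.mem_ofPred_eq, not_or, not_lt, not_le] at hcon hω
        obtain ⟨h1, h2⟩ := hcon
        have h3 : |I * D n ω| ≤ |Z n ω| + ε * |D n ω| := by
          have := abs_sub_abs_le_abs_sub (I * D n ω) (Z n ω)
          linarith
        rw [abs_mul, abs_of_pos hI] at h3
        have h4 : ε * |D n ω| ≤ I / 2 * |D n ω| := by gcongr; exact min_le_left _ _
        have h5 : |D n ω| ≤ 2 * M / I := by
          rw [le_div_iff₀ hI]
          linarith
        have h6 : ε * |D n ω| ≤ r * I ^ 2 / (4 * M) * (2 * M / I) := by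
          gcongr
          exact min_le_right _ _
        have h7 : r * I ^ 2 / (4 * M) * (2 * M / I) = r * I / 2 := by
          field_simp
          norm_num
        have h8 : D n ω - I⁻¹ * Z n ω = I⁻¹ * (I * D n ω - Z n ω) := by
          field_simp
        rw [Pi.zero_apply, sub_zero, Real.norm_eq_abs, h8, abs_mul, abs_of_pos (inv_pos.2 hI),
          ← div_eq_inv_mul, le_div_iff₀ hI] at hω
        have : 0 < r * I := by positivity
        linarith
    _ ≤ e / 2 + e / 2 := (measure_union_le _ _).trans (add_le_add hn ((hZ n M hM).trans hMe))
    _ = e := ENNReal.add_halves e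

end MLE

/-! ### Expansion of the likelihood equation and conclusion -/

namespace MLE

/-- The likelihood equation, expanded to first order around `θ`. -/
lemma abs_sum_obsScore_add_le {𝓧 : Type*} {Θ : Set ℝ} {ψ : ℝ → 𝓧 → ℝ} {t θ δ η : ℝ} {n : ℕ}
    {x : Fin n → 𝓧} {w : 𝓧 → ℝ} (hΘ : Metric.ball θ δ ⊆ Θ)
    (hx : ∀ j, IsRegularPoint ψ θ δ (x j)) (hη : η ≤ δ) (ht : t ∈ Metric.ball θ η)
    (hmax : IsMaxLikelihood Θ ψ n x t)
    (hw : ∀ j, ∀ s ∈ Metric.ball θ η,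
      |obsScoreDeriv ψ s (x j) - obsScoreDeriv ψ θ (x j)| ≤ w (x j)) :
    |∑ j, obsScore ψ θ (x j) + (t - θ) * ∑ j, obsScoreDeriv ψ θ (x j)| ≤
      (∑ j, w (x j)) * |t - θ| := by
  have htδ := Metric.ball_subset_ball hη ht
  have h0 : ∑ j, obsScore ψ t (x j) = 0 := by
    rw [← hmax.score_eq_zero hΘ hx htδ, score_eq_sum hx htδ]
    rfl
  have h1 : ∑ j, obsScore ψ θ (x j) + (t - θ) * ∑ j, obsScoreDeriv ψ θ (x j) =
      -∑ j, (obsScore ψ t (x j) - obsScore ψ θ (x j) - (t - θ) * obsScoreDeriv ψ θ (x j)) := by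
    rw [Finset.sum_sub_distrib, Finset.sum_sub_distrib, h0, Finset.mul_sum]
    ring
  rw [h1, abs_neg, Finset.sum_mul]
  exact (Finset.abs_sum_le_sum_abs _ _).trans (Finset.sum_le_sum fun j _ =>
    abs_deriv_sub_le (hx j).contDiffOn_log hη ht (hw j))

section Model

variable {𝓧 Ω : Type*} [MeasurableSpace 𝓧] [MeasurableSpace Ω] {ν : Measure 𝓧} {Θ : Set ℝ}
  {ψ : ℝ → 𝓧 → ℝ} {μ : Measure Ω} [IsProbabilityMeasure μ] {X : ℕ → Ω → 𝓧} {θ δ : ℝ}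
  {h : (n : ℕ) → (Fin n → 𝓧) → ℝ}

/-- The error is measured relative to `|D|`, because at this stage `√n (T - θ)` is not known to be
tight. -/
lemma tendsto_measure_asymptotically_linear (hdens : IsDensityFamily ν Θ ψ)
    (hX : ∀ j, Measurable (X j)) (hind : iIndepFun X μ)
    (hlaw : ∀ j, μ.map (X j) = obsLaw ν ψ θ)
    (hδ : 0 < δ) (hΘ : Metric.ball θ δ ⊆ Θ) (hreg : ∀ᵐ x ∂ν, IsRegularPoint ψ θ δ x)
    {H : 𝓧 → ℝ} (hH : Integrable H (obsLaw ν ψ θ))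
    (hHbound : ∀ᵐ x ∂ν, ∀ t ∈ Metric.ball θ δ, |obsScoreDeriv ψ t x| ≤ H x)
    {I : ℝ} (hint : Integrable (obsScoreDeriv ψ θ) (obsLaw ν ψ θ))
    (hI : ∫ x, obsScoreDeriv ψ θ x ∂obsLaw ν ψ θ = -I)
    (hmle : IsMLE Θ ψ X μ h) (hcons : IsConsistent X μ h θ) {ε : ℝ} (hε : 0 < ε) :
    Tendsto (fun n : ℕ => μ {ω | ε * |√(n : ℝ) * (estimator h X n ω - θ)| <
      |I * (√(n : ℝ) * (estimator h X n ω - θ)) -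
        (√(n : ℝ))⁻¹ * ∑ i ∈ Finset.range n, obsScore ψ θ (X i ω)|}) atTop (𝓝 0) := by
  have hac : obsLaw ν ψ θ ≪ ν := obsLaw_absolutelyContinuous
  obtain ⟨η, hη, hηδ, w, hwint, hwlt, hw⟩ := exists_integrable_oscillation_bound
    (f := fun t x => Real.log (ψ t x)) (μ := obsLaw ν ψ θ) hδ
    (fun t ht => (hdens.measurable t (hΘ ht)).log.aemeasurable)
    (hac.ae_le (hreg.mono fun x hx => hx.contDiffOn_log)) hH (hac.ae_le hHbound)
    (show 0 < ε / 4 by positivity)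
  have hgood : ∀ᵐ ω ∂μ, ∀ j, IsRegularPoint ψ θ δ (X j ω) ∧ ∀ s ∈ Metric.ball θ η,
      |obsScoreDeriv ψ s (X j ω) - obsScoreDeriv ψ θ (X j ω)| ≤ w (X j ω) := by
    rw [ae_all_iff]
    intro j
    have : ∀ᵐ x ∂(μ.map (X j)), IsRegularPoint ψ θ δ x ∧ ∀ s ∈ Metric.ball θ η,
        |obsScoreDeriv ψ s x - obsScoreDeriv ψ θ x| ≤ w x := by
      rw [hlaw j]
      exact Filter.Eventually.and (hac.ae_le hreg) hw
    exact ae_of_ae_map (hX j).aemeasurable this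
  have hJ := tendstoInMeasure_iff_norm.1 (tendstoInMeasure_sum_div hX hind hlaw hint) (ε / 2)
    (by positivity)
  have hW := tendstoInMeasure_iff_norm.1 (tendstoInMeasure_sum_div hX hind hlaw hwint) (ε / 4)
    (by positivity)
  have hC := tendstoInMeasure_iff_norm.1 hcons η hη
  -- Outside four events of vanishing probability (no maximum at `T`, `T` outside the `η`-ball, a
  -- deviation of `J / n`, a deviation of `W / n`) the estimate is deterministic up to a null set.
  have hlim := ((hmle.add hC).add hJ).add hW
  simp only [add_zero] at hlim
  refine tendsto_of_tendsto_of_tendsto_of_le_of_le' tendsto_const_nhds hlim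
    (Eventually.of_forall fun _ => zero_le) ?_
  filter_upwards [eventually_gt_atTop 0] with n hn
  refine le_trans (measure_mono_ae ?_) ((measure_union_le _ _).trans (add_le_add_left
    ((measure_union_le _ _).trans (add_le_add_left (measure_union_le _ _) _)) _))
  filter_upwards [hgood] with ω hω hbad
  refine by_contra fun hcon => ?_
  change ω ∉ (_ : Set Ω) at hcon
  simp only [Set.mem_union, Set.mem_ofPred_eq, not_or, not_not, not_le] at hcon
  obtain ⟨⟨⟨hmax, hball⟩, hJn⟩, hWn⟩ := hcon
  have hnpos : (0 : ℝ) < n := by exact_mod_cast hn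
  have hdiv : √(n : ℝ) / n = (√(n : ℝ))⁻¹ := Real.sqrt_div_self
  have hsqpos : 0 < √(n : ℝ) := Real.sqrt_pos.2 hnpos
  set T := estimator h X n ω
  have key := abs_sum_obsScore_add_le (x := sample X n ω) (w := w) hΘ (fun j => (hω j).1) hηδ
    (t := T) (by rwa [Metric.mem_ball, Real.dist_eq]) hmax (fun j => (hω j).2)
  simp only [sample] at key
  rw [Fin.sum_univ_eq_sum_range (fun i => obsScore ψ θ (X i ω)),
    Fin.sum_univ_eq_sum_range (fun i => obsScoreDeriv ψ θ (X i ω)),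
    Fin.sum_univ_eq_sum_range (fun i => w (X i ω))] at key
  set S := ∑ i ∈ Finset.range n, obsScore ψ θ (X i ω)
  set J := ∑ i ∈ Finset.range n, obsScoreDeriv ψ θ (X i ω)
  set W := ∑ i ∈ Finset.range n, w (X i ω)
  rw [hI, Real.norm_eq_abs, sub_neg_eq_add] at hJn
  rw [Real.norm_eq_abs] at hWn
  have hWlt : W / n < ε / 2 := by linarith [(abs_lt.1 hWn).2]
  have key2 : |(√(n : ℝ))⁻¹ * S + √(n : ℝ) * (T - θ) * (J / n)| ≤
      W / n * |√(n : ℝ) * (T - θ)| := by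
    have e1 : (√(n : ℝ))⁻¹ * S + √(n : ℝ) * (T - θ) * (J / n) =
        (√(n : ℝ))⁻¹ * (S + (T - θ) * J) := by
      linear_combination (T - θ) * J * hdiv
    have e2 : W / n * |√(n : ℝ) * (T - θ)| = (√(n : ℝ))⁻¹ * (W * |T - θ|) := by
      rw [abs_mul, abs_of_pos hsqpos]
      linear_combination W * |T - θ| * hdiv
    rw [e1, e2, abs_mul, abs_of_pos (inv_pos.2 hsqpos)]
    gcongr
  set D := √(n : ℝ) * (T - θ)
  -- Two sources of error, each at most `ε / 2 * |D|`: the fluctuation of `J / n` around `-I`, and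
  -- the Taylor remainder, where `W / n` is below `ε / 4 + ε / 4`.
  have e3 : I * D - (√(n : ℝ))⁻¹ * S = (J / n + I) * D - ((√(n : ℝ))⁻¹ * S + D * (J / n)) := by
    ring
  have hfin : |I * D - (√(n : ℝ))⁻¹ * S| ≤ ε / 2 * |D| + ε / 2 * |D| := by
    rw [e3]
    refine (abs_sub _ _).trans (add_le_add ?_ (key2.trans ?_))
    · rw [abs_mul]; gcongr
    · gcongr
  have hbad' : ε * |D| < |I * D - (√(n : ℝ))⁻¹ * S| := hbad
  linarith

/-- Asymptotic normality of a consistent maximum likelihood estimator. -/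
theorem tendstoInDistribution_estimator (hdens : IsDensityFamily ν Θ ψ)
    (hX : ∀ j, Measurable (X j)) (hind : iIndepFun X μ)
    (hlaw : ∀ j, μ.map (X j) = obsLaw ν ψ θ) (hmeas : ∀ n, Measurable (h n))
    (hreg : IsRegularAt ν Θ ψ θ) (hF : 0 < fisherInfo ν ψ 1 θ)
    (hmle : IsMLE Θ ψ X μ h) (hcons : IsConsistent X μ h θ) :
    TendstoInDistribution (fun (n : ℕ) ω => √(n : ℝ) * (estimator h X n ω - θ)) atTop
      (fun z : ℝ => z) (fun _ => μ) (gaussianReal 0 (fisherInfo ν ψ 1 θ)⁻¹.toNNReal) := by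
  obtain ⟨δ, hδ, hΘ, hpos, hC2, ⟨g, hg, hgb⟩, H, hH, hHb⟩ := hreg
  have hpt : ∀ᵐ x ∂ν, IsRegularPoint ψ θ δ x := hpos.and hC2
  have hL := memLp_obsScore hdens hδ hΘ hpt hF
  have h0 := integral_obsScore hdens hδ hΘ hpt hg hgb
  obtain ⟨hJ, hJI⟩ := integral_obsScoreDeriv hdens hδ hΘ hpt hg hgb hF
  have hV := fisherInfo_one hdens hδ hΘ hpt
  set I := fisherInfo ν ψ 1 θ
  -- Applying the central limit theorem to the score already divided by `I` gives the limiting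
  -- variance `I⁻² * I = I⁻¹` directly.
  have hclt := tendstoInDistribution_sum hX hind hlaw (hL.const_mul I⁻¹)
    (by rw [integral_const_mul, h0, mul_zero])
  have hvar : Var[fun x => I⁻¹ * obsScore ψ θ x; obsLaw ν ψ θ] = I⁻¹ := by
    rw [variance_const_mul, ← hV]
    field_simp
  rw! [hvar] at hclt
  refine tendstoInDistribution_of_tendstoInMeasure_sub _ _ hclt ?_ fun n => ?_
  · have hlin := tendstoInMeasure_sub_of_asymptotically_linear hF
      (fun n M hM => measure_le_abs_sum_le hX hind hlaw hL h0 n hM)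
      (fun ε hε => tendsto_measure_asymptotically_linear hdens hX hind hlaw hδ hΘ hpt hH hHb hJ hJI
        hmle hcons hε)
    convert hlin using 3 with n
    simp only [Pi.sub_apply, ← Finset.mul_sum]
    ring
  · have : Measurable (estimator h X n) :=
      (hmeas n).comp (measurable_pi_lambda _ fun j => hX j)
    exact ((this.sub_const _).const_mul _).aemeasurable

end Model

end MLE

theorem mainTheorem6 {𝓧 Ω : Type*} [MeasurableSpace 𝓧] [MeasurableSpace Ω]
    (ν : Measure 𝓧) (Θ : Set ℝ) (ψ : ℝ → 𝓧 → ℝ)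
    (P : Θ → Measure Ω) [∀ t, IsProbabilityMeasure (P t)] (X : ℕ → Ω → 𝓧)
    (hmodel : MLE.IsModel ν Θ ψ P X)
    (h : (n : ℕ) → (Fin n → 𝓧) → ℝ) (hmeas : ∀ n, Measurable (h n))
    (θ : Θ) (hreg : MLE.IsRegularAt ν Θ ψ θ) (hF : 0 < MLE.fisherInfo ν ψ 1 θ)
    (hmle : MLE.IsMLE Θ ψ X (P θ) h) (hcons : MLE.IsConsistent X (P θ) h θ) :
    TendstoInDistribution (fun (n : ℕ) ω => √(n : ℝ) * (MLE.estimator h X n ω - θ)) atTop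
        (fun z : ℝ => z) (fun _ => P θ)
        (gaussianReal 0 (MLE.fisherInfo ν ψ 1 θ)⁻¹.toNNReal) ∧
      (∀ n, MLE.fisherInfo ν ψ n θ = n * MLE.fisherInfo ν ψ 1 θ) ∧
      MLE.ApproxNormal (P θ) (MLE.estimator h X) θ
        (fun n => (MLE.fisherInfo ν ψ n θ)⁻¹.toNNReal) := by
  have hadd : ∀ n, MLE.fisherInfo ν ψ n θ = n * MLE.fisherInfo ν ψ 1 θ := by
    obtain ⟨δ, hδ, hΘ, hpos, hC2, -⟩ := hreg
    exact MLE.fisherInfo_eq_mul hmodel.density hδ hΘ (hpos.and hC2) hF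
  have hnormal := MLE.tendstoInDistribution_estimator hmodel.density hmodel.measurable
    (hmodel.indep θ) (hmodel.law θ) hmeas hreg hF hmle hcons
  refine ⟨hnormal, hadd, ?_⟩
  have hv : (MLE.fisherInfo ν ψ 1 θ)⁻¹.toNNReal ≠ 0 := (Real.toNNReal_pos.2 (inv_pos.2 hF)).ne'
  convert MLE.ApproxNormal.of_tendstoInDistribution hv hnormal using 2 with n
  -- Additivity turns the variance `I⁻¹ / n` into the inverse information of the sample; for `n = 0`
  -- both are `0` by convention.
  rw [hadd n, mul_inv, Real.toNNReal_mul (by positivity), Real.toNNReal_inv,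
    Real.toNNReal_natCast, mul_comm, div_eq_mul_inv]
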